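/- Let $\mathcal A=\mathbb R^m$, $\mathcal X=\mathbb R^N$, $\mathcal Y=\mathbb R^P$, let $\Theta\subseteq\mathbb R^d$ be open, and consider the iterative scheme $$x^{(\ell)}(y,\theta)=\gamma\big(a^{(\ell)}(y,\theta)\big),\qquad a^{(\ell+1)}(y,\theta)=\psi\big(a^{(\ell)}(y,\theta),y,\theta\big),\qquad a^{(0)}(y,\theta)=a_0(y,\theta),$$ with $\gamma:\mathcal A\to\mathcal X$ and $\psi:\mathcal A\times\mathcal Y\times\Theta\to\mathcal A$. Fix $y\in\mathcal Y$ and assume that $\gamma$ is non-expansive ($1$-Lipschitz), that $a\mapsto\psi(a,y,\theta)$ is Lipschitz with a constant independent of $\theta\in\Theta$, that $\theta\mapsto\psi(a,y,\theta)$ is Lipschitz on $\Theta$ with a constant independent of $a\in\mathcal A$, and that $\theta\mapsto a_0(y,\theta)$ is Lipschitz on $\Theta$. A weak partial derivative of a locally integrable $f:\Omega\to\mathbb R$ ($\Omega\subseteq\mathbb R^n$ open) in the $i$-th coordinate is a locally integrable $g$ on $\Omega$ with $\int_\Omega g\varphi=-\int_\Omega f\,\partial_i\varphi$ for all $\varphi\in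 C^1_c(\Omega)$; the weak Jacobian of a vector-valued map is the matrix field of the weak partial derivatives of its components. It is determined only Lebesgue-almost everywhere, and a particular representative is called a version of it. Then, for every $\ell\ge 0$, the maps $\theta\mapsto a^{(\ell)}(y,\theta)$ and $\theta\mapsto x^{(\ell)}(y,\theta)$ are weakly differentiable on $\Theta$. Moreover there are a version $\mathrm D\gamma$ of the weak Jacobian of $\gamma$ on $\mathcal A$, and maps $\mathrm D_1\psi(\cdot,y,\cdot)$ and $\mathrm D_3\psi(\cdot,y,\cdot)$ on $\mathcal A\times\Theta$ such that $\mathrm D_1\psi(\cdot,y,\theta)$ is a version of the weak Jacobian of $\psi(\cdot,y,\theta)$ on $\mathcal A$ for every $\theta\in\Theta$, and $\mathrm D_3\psi(a,y,\cdot)$ is a version of the weak Jacobian of $\psi(a,y,\cdot)$ on $\Theta$ for every $a\in\mathcal A$, each of the three coinciding with the corresponding classical (partial) Jacobian at every point where the latter exists, such that the weak Jacobians $\mathcal J_a^{(\ell)}$ and $\mathcal J_x^{(\ell)}$ of $\theta\mapsto a^{(\ell)}(y,\theta)$ and $\theta\mapsto x^{(\ell)}(y,\theta)$ on $\Theta$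 satisfy, for every $\ell\ge 0$ and Lebesgue-almost every $\theta\in\Theta$, $$\mathcal J_x^{(\ell)}=\Gamma_a^{(\ell)}\,\mathcal J_a^{(\ell)},\qquad \mathcal J_a^{(\ell+1)}=\Psi_a^{(\ell)}\,\mathcal J_a^{(\ell)}+\Psi_\theta^{(\ell)},$$ where $\Gamma_a^{(\ell)}=\mathrm D\gamma(a^{(\ell)})$, $\Psi_a^{(\ell)}=\mathrm D_1\psi(a^{(\ell)},y,\theta)$ and $\Psi_\theta^{(\ell)}=\mathrm D_3\psi(a^{(\ell)},y,\theta)$ with $a^{(\ell)}=a^{(\ell)}(y,\theta)$. -/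

import Mathlib

open MeasureTheory

/-- `g` is a weak partial derivative of `f` with respect to the `i`-th coordinate on the open
set `Ω ⊆ ℝⁿ`: both are locally integrable on `Ω`, and
`∫_Ω g φ = - ∫_Ω f ∂φ/∂aᵢ` for all `φ ∈ C_c¹(Ω)`. -/
def IsWeakPartialDeriv {n : ℕ} (Ω : Set (EuclideanSpace ℝ (Fin n))) (i : Fin n)
    (f g : EuclideanSpace ℝ (Fin n) → ℝ) : Prop :=
  LocallyIntegrableOn f Ω volume ∧ LocallyIntegrableOn g Ω volume ∧
    ∀ φ : EuclideanSpace ℝ (Fin n) → ℝ,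
      ContDiff ℝ 1 φ → HasCompactSupport φ → tsupport φ ⊆ Ω →
        ∫ a in Ω, g a * φ a = - ∫ a in Ω, f a * fderiv ℝ φ a (EuclideanSpace.single i 1)

/-- `J` is (a version of) the weak Jacobian of `h : ℝⁿ → ℝᵖ` on the open set `Ω`: the entry
`(k, i)` of `J` is a weak partial derivative of the component `h_k` in the `i`-th coordinate. -/
def IsWeakJacobian {n p : ℕ} (Ω : Set (EuclideanSpace ℝ (Fin n)))
    (h : EuclideanSpace ℝ (Fin n) → EuclideanSpace ℝ (Fin p))
    (J : EuclideanSpace ℝ (Fin n) → EuclideanSpace ℝ (Fin n) →L[ℝ] EuclideanSpace ℝ (Fin p)) :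
    Prop :=
  ∀ (k : Fin p) (i : Fin n),
    IsWeakPartialDeriv Ω i (fun a => h a k) (fun a => J a (EuclideanSpace.single i 1) k)

/-- `h` is weakly differentiable on `Ω`: all weak partial derivatives of its components exist. -/
def WeaklyDifferentiableOn {n p : ℕ} (Ω : Set (EuclideanSpace ℝ (Fin n)))
    (h : EuclideanSpace ℝ (Fin n) → EuclideanSpace ℝ (Fin p)) : Prop :=
  ∀ (k : Fin p) (i : Fin n), ∃ g : EuclideanSpace ℝ (Fin n) → ℝ,
    IsWeakPartialDeriv Ω i (fun a => h a k) g

/-- The auxiliary iterates `a⁽⁰⁾ = a₀`, `a⁽ˡ⁺¹⁾ = ψ(a⁽ˡ⁾, y, θ)`, as functions of `(y, θ)`. -/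
def auxIterate {A Y T : Type*} (ψ : A → Y → T → A) (a₀ : Y → T → A) : ℕ → Y → T → A
  | 0 => a₀
  | l + 1 => fun y θ => ψ (auxIterate ψ a₀ l y θ) y θ

/-- The iterates `x⁽ˡ⁾ = γ(a⁽ˡ⁾)`, as functions of `(y, θ)`. -/
def mainIterate {A X Y T : Type*} (γ : A → X) (ψ : A → Y → T → A) (a₀ : Y → T → A)
    (l : ℕ) (y : Y) (θ : T) : X :=
  γ (auxIterate ψ a₀ l y θ)

/-! The usual chain rule is unavailable: an iterate may map a set of positive measure into the null
set where `γ` or `ψ` is not differentiable. Instead, for Lipschitz `f` and `h`, almost every `θ` has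
the following property: every `Dh(θ)v` is an additive direction of `f` at `h θ`, with line
derivative `D(f ∘ h)(θ)v` (`LipschitzWith.ae_hasLineDerivAt_add`). Additive directions form a
subspace, depending only on `f` and the point, on which line derivatives are linear. A linear
extension of them is thus a version of the Jacobian that serves every `h`, hence every iterate, at
once. For `ψ`, apply this to `h θ = (a θ, θ)`. The extension must also match both partial Jacobians
where they exist. It can, because the additive directions then project onto the whole parameter
space (`exists_clm_extending_partial_fderiv`). -/

open Filter Topology Set

/-! ### Additive directions and tangents to sets. -/

section LineDerivatives

variable {E F : Type*} [NormedAddCommGroup E] [NormedSpace ℝ E]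
  [NormedAddCommGroup F] [NormedSpace ℝ F]

/-- The directions `w` along which `f` has a line derivative at `p` that is additive against every
other existing line derivative of `f` at `p`. -/
def additiveDirections (f : E → F) (p : E) : Submodule ℝ E where
  carrier := {w | ∃ fw, ∀ u fu, HasLineDerivAt ℝ f fu p u → HasLineDerivAt ℝ f (fu + fw) p (u + w)}
  zero_mem' := ⟨0, fun u fu h => by simpa using h⟩
  add_mem' := by
    rintro w₁ w₂ ⟨a₁, h₁⟩ ⟨a₂, h₂⟩
    refine ⟨a₁ + a₂, fun u fu h => ?_⟩
    simpa only [add_assoc] using h₂ _ _ (h₁ _ _ h)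
  smul_mem' := by
    rintro c w ⟨a, ha⟩
    rcases eq_or_ne c 0 with rfl | hc
    · exact ⟨0, fun u fu h => by simpa using h⟩
    · refine ⟨c • a, fun u fu h => ?_⟩
      simpa [smul_smul, hc] using (ha _ _ (h.smul c⁻¹)).smul c

theorem hasLineDerivAt_of_mem_additiveDirections {f : E → F} {p w : E}
    (hw : w ∈ additiveDirections f p) : HasLineDerivAt ℝ f (lineDeriv ℝ f p w) p w := by
  obtain ⟨a, ha⟩ := hw
  have h := ha 0 0 hasLineDerivAt_zero
  rw [zero_add, zero_add] at h
  rwa [h.lineDeriv]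

theorem HasLineDerivAt.add_of_mem_additiveDirections {f : E → F} {p u w : E} {fu : F}
    (hu : HasLineDerivAt ℝ f fu p u) (hw : w ∈ additiveDirections f p) :
    HasLineDerivAt ℝ f (fu + lineDeriv ℝ f p w) p (u + w) := by
  obtain ⟨a, ha⟩ := hw
  have h := ha 0 0 hasLineDerivAt_zero
  rw [zero_add, zero_add] at h
  rw [h.lineDeriv]
  exact ha _ _ hu

/-- If the line derivatives of `f` at `p` are linear on a subspace `W`, they are linear on the sum
of `W` with the additive directions. -/
theorem exists_clm_hasLineDerivAt_sup [FiniteDimensional ℝ E] {f : E → F} {p : E}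
    {W : Submodule ℝ E} {S : E →L[ℝ] F} (hS : ∀ w ∈ W, HasLineDerivAt ℝ f (S w) p w) :
    ∃ T : E →L[ℝ] F, ∀ w ∈ additiveDirections f p ⊔ W, HasLineDerivAt ℝ f (T w) p w := by
  have key : ∀ l ∈ additiveDirections f p, ∀ w ∈ W,
      HasLineDerivAt ℝ f (S w + lineDeriv ℝ f p l) p (w + l) := fun l hl w hw =>
    (hS w hw).add_of_mem_additiveDirections hl
  -- Additivity: regroup the sum as a `W` part plus an additive part; `S` is linear on the former,
  -- and the latter splits off by definition.
  let g : ↥(additiveDirections f p ⊔ W) →ₗ[ℝ] F :=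
    { toFun := fun x => lineDeriv ℝ f p (x : E)
      map_add' := by
        rintro ⟨x, hx⟩ ⟨z, hz⟩
        obtain ⟨l, hl, w, hw, rfl⟩ := Submodule.mem_sup.1 hx
        obtain ⟨l', hl', w', hw', rfl⟩ := Submodule.mem_sup.1 hz
        have e : (l + w) + (l' + w') = (w + w') + (l + l') := by abel
        have h1 := (key _ (add_mem hl hl') _ (add_mem hw hw')).lineDeriv
        have h2 := (key _ hl _ hw).lineDeriv
        have h3 := (key _ hl' _ hw').lineDeriv
        have h4 := ((hasLineDerivAt_of_mem_additiveDirections hl).add_of_mem_additiveDirections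
          hl').lineDeriv
        change lineDeriv ℝ f p ((l + w) + (l' + w')) = lineDeriv ℝ f p (l + w) +
          lineDeriv ℝ f p (l' + w')
        rw [e, h1, add_comm l w, h2, add_comm l' w', h3, h4, map_add]
        abel
      map_smul' := fun c x => lineDeriv_smul }
  obtain ⟨T, hT⟩ := LinearMap.exists_extend g
  refine ⟨LinearMap.toContinuousLinearMap T, fun x hx => ?_⟩
  have e : T x = lineDeriv ℝ f p x := LinearMap.congr_fun hT ⟨x, hx⟩
  obtain ⟨l, hl, w, hw, rfl⟩ := Submodule.mem_sup.1 hx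
  have h := key l hl w hw
  rw [add_comm w l] at h
  rw [LinearMap.coe_toContinuousLinearMap', e, h.lineDeriv]
  exact h

theorem exists_clm_hasLineDerivAt_additiveDirections [FiniteDimensional ℝ E] (f : E → F) (p : E) :
    ∃ T : E →L[ℝ] F, ∀ w ∈ additiveDirections f p, HasLineDerivAt ℝ f (T w) p w := by
  obtain ⟨T, hT⟩ := exists_clm_hasLineDerivAt_sup (f := f) (p := p) (W := ⊥) (S := 0)
    (fun w hw => by rw [(Submodule.mem_bot ℝ).1 hw]; exact hasLineDerivAt_zero)
  exact ⟨T, fun w hw => hT w (Submodule.mem_sup_left hw)⟩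

theorem norm_smul_sub_smul_le {x z : E} {κ : ℝ} (s : ℝ) (h : ‖x - z‖ ≤ κ) :
    ‖s • x - s • z‖ ≤ κ * |s| := by
  rw [← smul_sub, norm_smul, Real.norm_eq_abs, mul_comm]
  gcongr

theorem hasLineDerivAt_iff_eventually_norm_le {f : E → F} {f' : F} {p v : E} :
    HasLineDerivAt ℝ f f' p v ↔
      ∀ ε > 0, ∀ᶠ s in 𝓝 (0 : ℝ), ‖f (p + s • v) - f p - s • f'‖ ≤ ε * |s| := by
  rw [hasLineDerivAt_iff_isLittleO_nhds_zero, Asymptotics.isLittleO_iff]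
  simp only [Real.norm_eq_abs, gt_iff_lt]

/-- Where the distance to a set is differentiable at a point of that set, the set comes close to
every line through the point. -/
theorem eventually_exists_dist_le_of_differentiableAt_infDist {A : Set E} {x : E} (hx : x ∈ A)
    (hd : DifferentiableAt ℝ (fun z => Metric.infDist z A) x) (v : E) {ε : ℝ} (hε : 0 < ε) :
    ∀ᶠ s in 𝓝 (0 : ℝ), ∃ z ∈ A, dist (x + s • v) z ≤ ε * |s| := by
  have h0 : fderiv ℝ (fun z => Metric.infDist z A) x = 0 := by
    apply IsLocalMin.fderiv_eq_zero
    refine Eventually.of_forall fun z => ?_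
    simp only [Metric.infDist_zero_of_mem hx]
    exact Metric.infDist_nonneg
  -- The infimum need not be attained; halving `ε` leaves room for an actual point of `A`.
  have h := hasLineDerivAt_iff_eventually_norm_le.1 (hd.hasFDerivAt.hasLineDerivAt v) (ε / 2)
    (half_pos hε)
  filter_upwards [h] with s hs
  rcases eq_or_ne s 0 with rfl | hs0
  · exact ⟨x, hx, by simp⟩
  · simp only [h0, Metric.infDist_zero_of_mem hx, _root_.zero_apply, smul_zero,
      sub_zero, Real.norm_eq_abs, abs_of_nonneg Metric.infDist_nonneg] at hs
    have hpos : 0 < |s| := abs_pos.2 hs0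
    obtain ⟨z, hz, hlt⟩ := (Metric.infDist_lt_iff ⟨x, hx⟩).1
      (lt_of_le_of_lt hs (show ε / 2 * |s| < ε * |s| by nlinarith))
    exact ⟨z, hz, hlt.le⟩

end LineDerivatives

/-! ### Chain rule along a Lipschitz map. -/

section ChainRule

variable {D E F : Type*} [NormedAddCommGroup D] [NormedSpace ℝ D] [FiniteDimensional ℝ D]
  [NormedAddCommGroup E] [NormedSpace ℝ E] [FiniteDimensional ℝ E]
  [NormedAddCommGroup F] [NormedSpace ℝ F] [FiniteDimensional ℝ F]

/-- The points at whose image `f` has approximate line derivative `r` in the direction `q`, up to an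
error `ε`, on the scale `δ`. -/
def approxLineDerivSet (f : E → F) (h : D → E) (q : E) (r : F) (ε δ : ℝ) : Set D :=
  {θ | ∀ s : ℝ, |s| ≤ δ → ‖f (h θ + s • q) - f (h θ) - s • r‖ ≤ ε * |s|}

/-- Along a Lipschitz map `h`, almost every tangent direction of `h` is an additive direction of a
Lipschitz function `f`, and the line derivative is given by the derivative of the composition. -/
theorem LipschitzWith.ae_hasLineDerivAt_add [MeasurableSpace D] [BorelSpace D] {μ : Measure D}
    [μ.IsAddHaarMeasure] {f : E → F} {h : D → E} {C K : NNReal} (hf : LipschitzWith C f)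
    (hh : LipschitzWith K h) :
    ∀ᵐ θ ∂μ, ∀ v u fu, HasLineDerivAt ℝ f fu (h θ) u →
      HasLineDerivAt ℝ f (fu + fderiv ℝ (f ∘ h) θ v) (h θ) (u + fderiv ℝ h θ v) := by
  -- Countably many sets, indexed by dense sequences, give one null set valid for all `u` and `fu`.
  -- Rademacher applies to each distance function.
  have hcount : ∀ᵐ θ ∂μ, ∀ i j n k : ℕ, DifferentiableAt ℝ (fun z => Metric.infDist z
      (approxLineDerivSet f h (TopologicalSpace.denseSeq E i) (TopologicalSpace.denseSeq F j)
        (1 / ((n : ℝ) + 1)) (1 / ((k : ℝ) + 1)))) θ := by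
    simp only [ae_all_iff]
    exact fun i j n k => (Metric.lipschitz_infDist_pt _).ae_differentiableAt
  filter_upwards [hcount, hh.ae_differentiableAt, (hf.comp hh).ae_differentiableAt]
    with θ hA hhd hfd v u fu hu
  rw [hasLineDerivAt_iff_eventually_norm_le] at hu ⊢
  intro ε hε
  -- Bounds the sum of all error coefficients at the end, which is `2 * C + 2 * C * K + 3`.
  set M : ℝ := 2 * C + 2 * C * K + 4 with hM
  have hMpos : 0 < M := by positivity
  obtain ⟨n, hn⟩ := exists_nat_one_div_lt (div_pos hε hMpos)
  set η : ℝ := 1 / ((n : ℝ) + 1) with hη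
  have hηpos : 0 < η := by positivity
  -- Replacing `u`, `fu` by `q`, `r` costs `C * κ + κ`, and the line derivative itself another `κ`.
  set κ : ℝ := η / (C + 2) with hκ
  have hC2 : (0 : ℝ) < C + 2 := by positivity
  have hκpos : 0 < κ := by positivity
  have hκη : κ * (C + 2) = η := by rw [hκ]; field_simp
  have hκle : κ ≤ η := by nlinarith [C.coe_nonneg]
  obtain ⟨i, hi⟩ := (TopologicalSpace.denseRange_denseSeq E).exists_dist_lt u hκpos
  obtain ⟨j, hj⟩ := (TopologicalSpace.denseRange_denseSeq F).exists_dist_lt fu hκpos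
  set q := TopologicalSpace.denseSeq E i
  set r := TopologicalSpace.denseSeq F j
  rw [dist_eq_norm] at hi hj
  have hLip : ∀ x z : E, ‖f x - f z‖ ≤ C * ‖x - z‖ := fun x z => by
    simpa [dist_eq_norm] using hf.dist_le_mul x z
  have hLip' : ∀ x z : D, ‖h x - h z‖ ≤ K * ‖x - z‖ := fun x z => by
    simpa [dist_eq_norm] using hh.dist_le_mul x z
  obtain ⟨δ, hδ, hball⟩ := Metric.eventually_nhds_iff.1 (hu κ hκpos)
  obtain ⟨k, hk⟩ := exists_nat_one_div_lt hδ
  have hmem : θ ∈ approxLineDerivSet f h q r η (1 / ((k : ℝ) + 1)) := by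
    intro s hs
    have h1 := hball (y := s) (by simpa using hs.trans_lt hk)
    have h2 := hLip (h θ + s • q) (h θ + s • u)
    have h3 := norm_smul_sub_smul_le s hi.le
    have h4 := norm_smul_sub_smul_le s hj.le
    rw [add_sub_add_left_eq_sub, norm_sub_rev (s • q)] at h2
    have h5 : C * ‖s • u - s • q‖ ≤ C * (κ * |s|) := by gcongr
    calc ‖f (h θ + s • q) - f (h θ) - s • r‖
        = ‖(f (h θ + s • q) - f (h θ + s • u)) + (f (h θ + s • u) - f (h θ) - s • fu)
            + (s • fu - s • r)‖ := by congr 1; abel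
      _ ≤ C * (κ * |s|) + κ * |s| + κ * |s| :=
          (norm_add₃_le).trans (add_le_add (add_le_add (h2.trans h5) h1) h4)
      _ = κ * (C + 2) * |s| := by ring
      _ = η * |s| := by rw [hκη]
  have hk1 : (0 : ℝ) < 1 / ((k : ℝ) + 1) := by positivity
  have hsm : ∀ᶠ s in 𝓝 (0 : ℝ), |s| ≤ 1 / ((k : ℝ) + 1) := by
    filter_upwards [Metric.closedBall_mem_nhds (0 : ℝ) hk1] with s hs
    simpa using hs
  filter_upwards [hsm, eventually_exists_dist_le_of_differentiableAt_infDist hmem (hA i j n k) v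
      hηpos,
    hasLineDerivAt_iff_eventually_norm_le.1 (hhd.hasFDerivAt.hasLineDerivAt v) η hηpos,
    hasLineDerivAt_iff_eventually_norm_le.1 (hfd.hasFDerivAt.hasLineDerivAt v) η hηpos]
    with s hs ⟨θ', hθ', hdist⟩ hhs hfs
  rw [dist_eq_norm] at hdist
  set w := fderiv ℝ h θ v
  set β := fderiv ℝ (f ∘ h) θ v
  simp only [Function.comp_apply] at hfs
  have hz := hLip' (θ + s • v) θ'
  have hz' : ‖h (θ + s • v) - h θ'‖ ≤ K * (η * |s|) := hz.trans (by gcongr)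
  have huq := norm_smul_sub_smul_le s hi.le
  have huq' : ‖s • u - s • q‖ ≤ η * |s| := huq.trans (by gcongr)
  have hfr' : ‖s • r - s • fu‖ ≤ η * |s| := by
    rw [norm_sub_rev]; exact (norm_smul_sub_smul_le s hj.le).trans (by gcongr)
  have t1 : ‖f (h θ + s • (u + w)) - f (h θ' + s • q)‖
      ≤ C * (η * |s| + K * (η * |s|) + η * |s|) := by
    refine (hLip _ _).trans ?_
    gcongr
    calc ‖h θ + s • (u + w) - (h θ' + s • q)‖
        = ‖(-(h (θ + s • v) - h θ - s • w)) + (h (θ + s • v) - h θ')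
            + (s • u - s • q)‖ := by congr 1; rw [smul_add]; abel
      _ ≤ _ := (norm_add₃_le).trans
          (add_le_add (add_le_add (by rwa [norm_neg]) hz') huq')
  have t2 := hθ' s hs
  have t3 : ‖f (h θ') - f (h (θ + s • v))‖ ≤ C * (K * (η * |s|)) := by
    refine (hLip _ _).trans ?_
    rw [norm_sub_rev]
    gcongr
  have hη' : η * M ≤ ε := by
    rw [lt_div_iff₀ hMpos] at hn
    exact hn.le
  -- Detour through `θ'`, a point of the set close to `θ + s • v`: there the increment along `q` is
  -- still about `s • r`, while moving the base point from `h θ` to `h θ'` contributes about `s •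
  -- β`.
  calc ‖f (h θ + s • (u + w)) - f (h θ) - s • (fu + β)‖
      = ‖(f (h θ + s • (u + w)) - f (h θ' + s • q))
          + (f (h θ' + s • q) - f (h θ') - s • r)
          + ((f (h θ') - f (h (θ + s • v))) + (f (h (θ + s • v)) - f (h θ) - s • β)
            + (s • r - s • fu))‖ := by congr 1; rw [smul_add s fu]; abel
    _ ≤ C * (η * |s| + K * (η * |s|) + η * |s|) + η * |s|
          + (C * (K * (η * |s|)) + η * |s| + η * |s|) :=
        (norm_add₃_le).trans (add_le_add (add_le_add t1 t2)
          ((norm_add₃_le).trans (add_le_add (add_le_add t3 hfs) hfr')))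
    _ ≤ η * M * |s| := by
        have : 0 ≤ η * |s| := by positivity
        rw [hM]; nlinarith
    _ ≤ ε * |s| := by gcongr

theorem LipschitzWith.ae_fderiv_mem_additiveDirections [MeasurableSpace D] [BorelSpace D]
    {μ : Measure D} [μ.IsAddHaarMeasure] {f : E → F} {h : D → E} {C K : NNReal}
    (hf : LipschitzWith C f) (hh : LipschitzWith K h) :
    ∀ᵐ θ ∂μ, ∀ v, fderiv ℝ h θ v ∈ additiveDirections f (h θ) ∧
      HasLineDerivAt ℝ f (fderiv ℝ (f ∘ h) θ v) (h θ) (fderiv ℝ h θ v) := by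
  filter_upwards [hf.ae_hasLineDerivAt_add hh] with θ hθ v
  refine ⟨⟨_, hθ v⟩, ?_⟩
  simpa using hθ v 0 0 hasLineDerivAt_zero

end ChainRule

/-! ### Weak Jacobians: uniqueness, and Lipschitz maps. -/

section WeakDerivatives

variable {n p : ℕ} {Ω : Set (EuclideanSpace ℝ (Fin n))}

theorem MeasureTheory.LocallyIntegrableOn.congr_ae_restrict {X G : Type*} [TopologicalSpace X]
    [MeasurableSpace X] [NormedAddCommGroup G] {μ : Measure X} {s : Set X} {f g : X → G}
    (hf : LocallyIntegrableOn f s μ) (h : f =ᵐ[μ.restrict s] g) :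
    LocallyIntegrableOn g s μ := by
  intro x hx
  obtain ⟨t, ht, hft⟩ := hf x hx
  obtain ⟨u, hu, hxu, hut⟩ := mem_nhdsWithin.1 ht
  refine ⟨u ∩ s, mem_nhdsWithin.2 ⟨u, hu, hxu, subset_rfl⟩, ?_⟩
  exact (hft.mono_set hut).congr (ae_mono (Measure.restrict_mono inter_subset_right le_rfl) h)

theorem IsWeakPartialDeriv.congr {i : Fin n} {f f' g g' : EuclideanSpace ℝ (Fin n) → ℝ}
    (h : IsWeakPartialDeriv Ω i f g) (hf : f =ᵐ[volume.restrict Ω] f')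
    (hg : g =ᵐ[volume.restrict Ω] g') : IsWeakPartialDeriv Ω i f' g' := by
  refine ⟨h.1.congr_ae_restrict hf, h.2.1.congr_ae_restrict hg, fun φ h1 h2 h3 => ?_⟩
  have ef : ∫ a in Ω, f' a * fderiv ℝ φ a (EuclideanSpace.single i 1) =
      ∫ a in Ω, f a * fderiv ℝ φ a (EuclideanSpace.single i 1) :=
    integral_congr_ae (hf.mono fun x hx => by simp only [hx])
  have eg : ∫ a in Ω, g' a * φ a = ∫ a in Ω, g a * φ a :=
    integral_congr_ae (hg.mono fun x hx => by simp only [hx])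
  rw [ef, eg]
  exact h.2.2 φ h1 h2 h3

theorem IsWeakPartialDeriv.ae_eq {i : Fin n} {f g g' : EuclideanSpace ℝ (Fin n) → ℝ}
    (h : IsWeakPartialDeriv Ω i f g) (h' : IsWeakPartialDeriv Ω i f g') (hΩ : IsOpen Ω) :
    g =ᵐ[volume.restrict Ω] g' := by
  have key : ∀ᵐ x ∂(volume : Measure (EuclideanSpace ℝ (Fin n))), x ∈ Ω → (g - g') x = 0 := by
    refine hΩ.ae_eq_zero_of_integral_contDiff_smul_eq_zero (h.2.1.sub h'.2.1) ?_
    intro φ hφ hc hs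
    have hφ1 : ContDiff ℝ 1 φ := hφ.of_le (by exact_mod_cast le_top)
    have hint : ∀ k : EuclideanSpace ℝ (Fin n) → ℝ, LocallyIntegrableOn k Ω volume →
        IntegrableOn (fun x => k x * φ x) Ω := fun k hk => by
      have h1 : IntegrableOn (fun x => k x * φ x) (tsupport φ) :=
        (hk.integrableOn_compact_subset hs hc).mul_continuousOn hφ.continuous.continuousOn hc
      refine h1.of_forall_sdiff_eq_zero hΩ.measurableSet fun x hx => ?_
      rw [image_eq_zero_of_notMem_tsupport hx.2, mul_zero]
    have e := (h.2.2 φ hφ1 hc hs).trans (h'.2.2 φ hφ1 hc hs).symm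
    have e0 : ∫ x, φ x • (g - g') x = ∫ x in Ω, φ x • (g - g') x := by
      refine (setIntegral_eq_integral_of_forall_compl_eq_zero fun x hx => ?_).symm
      rw [image_eq_zero_of_notMem_tsupport fun hx' => hx (hs hx'), zero_smul]
    rw [e0]
    calc ∫ x in Ω, φ x • (g - g') x = ∫ x in Ω, (g x * φ x - g' x * φ x) := by
          refine integral_congr_ae (Eventually.of_forall fun x => ?_)
          simp only [Pi.sub_apply, smul_eq_mul]; ring
      _ = 0 := by rw [integral_sub (hint g h.2.1) (hint g' h'.2.1), e, sub_self]
  rw [EventuallyEq, ae_restrict_iff' hΩ.measurableSet]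
  filter_upwards [key] with x hx hxΩ using sub_eq_zero.1 (hx hxΩ)

theorem IsWeakJacobian.congr {f f' : EuclideanSpace ℝ (Fin n) → EuclideanSpace ℝ (Fin p)}
    {J J' : EuclideanSpace ℝ (Fin n) → EuclideanSpace ℝ (Fin n) →L[ℝ] EuclideanSpace ℝ (Fin p)}
    (h : IsWeakJacobian Ω f J) (hf : f =ᵐ[volume.restrict Ω] f')
    (hJ : J =ᵐ[volume.restrict Ω] J') : IsWeakJacobian Ω f' J' := fun k i =>
  (h k i).congr (hf.mono fun x hx => by simp only [hx]) (hJ.mono fun x hx => by simp only [hx])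

theorem IsWeakJacobian.ae_eq {f : EuclideanSpace ℝ (Fin n) → EuclideanSpace ℝ (Fin p)}
    {J J' : EuclideanSpace ℝ (Fin n) → EuclideanSpace ℝ (Fin n) →L[ℝ] EuclideanSpace ℝ (Fin p)}
    (h : IsWeakJacobian Ω f J) (h' : IsWeakJacobian Ω f J') (hΩ : IsOpen Ω) :
    J =ᵐ[volume.restrict Ω] J' := by
  have : ∀ᵐ x ∂(volume.restrict Ω), ∀ k i,
      J x (EuclideanSpace.single i 1) k = J' x (EuclideanSpace.single i 1) k := by
    simp only [ae_all_iff]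
    exact fun k i => (h k i).ae_eq (h' k i) hΩ
  filter_upwards [this] with x hx
  have e : (J x).toLinearMap = (J' x).toLinearMap := by
    refine (EuclideanSpace.basisFun (Fin n) ℝ).toBasis.ext fun i => ?_
    ext k
    simpa using hx k i
  ext v k
  exact congrArg (fun T => T v k) e

theorem IsWeakJacobian.weaklyDifferentiableOn
    {f : EuclideanSpace ℝ (Fin n) → EuclideanSpace ℝ (Fin p)}
    {J : EuclideanSpace ℝ (Fin n) → EuclideanSpace ℝ (Fin n) →L[ℝ] EuclideanSpace ℝ (Fin p)}
    (h : IsWeakJacobian Ω f J) : WeaklyDifferentiableOn Ω f := fun k i => ⟨_, h k i⟩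

/-- The classical line derivatives of a Lipschitz function are weak partial derivatives. -/
theorem LipschitzWith.isWeakPartialDeriv_lineDeriv {f : EuclideanSpace ℝ (Fin n) → ℝ} {C : NNReal}
    (hf : LipschitzWith C f) (i : Fin n) :
    IsWeakPartialDeriv Ω i f (fun x => lineDeriv ℝ f x (EuclideanSpace.single i 1)) := by
  refine ⟨hf.continuous.locallyIntegrable.locallyIntegrableOn _,
    (hf.locallyIntegrable_lineDeriv _).locallyIntegrableOn _, fun φ h1 h2 h3 => ?_⟩
  obtain ⟨D, hD⟩ := h1.lipschitzWith_of_hasCompactSupport h2 one_ne_zero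
  have e := hf.integral_lineDeriv_mul_eq (μ := volume) hD h2 (EuclideanSpace.single i 1)
  rw [setIntegral_eq_integral_of_forall_compl_eq_zero, e,
    setIntegral_eq_integral_of_forall_compl_eq_zero, ← integral_neg]
  · refine integral_congr_ae (Eventually.of_forall fun x => ?_)
    have hd : DifferentiableAt ℝ φ x := h1.differentiable one_ne_zero x
    simp only [hd.lineDeriv_eq_fderiv, map_neg]
    ring
  · intro x hx
    rw [fderiv_of_notMem_tsupport ℝ fun hx' => hx (h3 hx')]
    simp
  · intro x hx
    rw [image_eq_zero_of_notMem_tsupport fun hx' => hx (h3 hx'), mul_zero]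

theorem LipschitzWith.isWeakJacobian_fderiv {C : NNReal}
    {f : EuclideanSpace ℝ (Fin n) → EuclideanSpace ℝ (Fin p)} (hf : LipschitzWith C f) :
    IsWeakJacobian Ω f (fderiv ℝ f) := by
  intro k i
  have hk : LipschitzWith (1 * C) (fun a => f a k) :=
    (LipschitzWith.of_dist_le_mul fun x z => by
      simpa [dist_eq_norm] using PiLp.norm_apply_le (x - z) k :
      LipschitzWith 1 fun x : EuclideanSpace ℝ (Fin p) => x k).comp hf
  refine (hk.isWeakPartialDeriv_lineDeriv i).congr EventuallyEq.rfl (ae_restrict_of_ae ?_)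
  filter_upwards [hf.ae_differentiableAt] with x hx
  exact ((((EuclideanSpace.proj k : EuclideanSpace ℝ (Fin p) →L[ℝ] ℝ).hasFDerivAt).comp x
    hx.hasFDerivAt).hasLineDerivAt _).lineDeriv

/-- By Rademacher, `J` agrees with `fderiv ℝ f` almost everywhere on `Ω`, so a pointwise choice of
`J` needs no separate measurability argument. A map given only on `Ω` is handled through a global
Lipschitz extension `f`. -/
theorem LipschitzWith.isWeakJacobian {C : NNReal}
    {f f' : EuclideanSpace ℝ (Fin n) → EuclideanSpace ℝ (Fin p)}
    {J : EuclideanSpace ℝ (Fin n) → EuclideanSpace ℝ (Fin n) →L[ℝ] EuclideanSpace ℝ (Fin p)}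
    (hf : LipschitzWith C f) (hΩ : MeasurableSet Ω) (hff' : EqOn f f' Ω)
    (hJ : ∀ x ∈ Ω, DifferentiableAt ℝ f x → J x = fderiv ℝ f x) : IsWeakJacobian Ω f' J := by
  refine hf.isWeakJacobian_fderiv.congr (ae_restrict_of_forall_mem hΩ hff') ?_
  rw [EventuallyEq, ae_restrict_iff' hΩ]
  filter_upwards [hf.ae_differentiableAt] with x hx hxΩ using (hJ x hxΩ hx).symm

end WeakDerivatives

/-! ### Choosing compatible versions of the Jacobians. -/

section PartialDerivatives

variable {A D F : Type*} [NormedAddCommGroup A] [NormedSpace ℝ A]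
  [NormedAddCommGroup D] [NormedSpace ℝ D]
  [NormedAddCommGroup F] [NormedSpace ℝ F]

theorem DifferentiableAt.hasLineDerivAt_inl {f : A × D → F} {p : A × D}
    (h : DifferentiableAt ℝ (fun a => f (a, p.2)) p.1) (v : A) :
    HasLineDerivAt ℝ f (fderiv ℝ (fun a => f (a, p.2)) p.1 v) p (v, 0) := by
  obtain ⟨a, t⟩ := p
  simpa [HasLineDerivAt] using h.hasFDerivAt.hasLineDerivAt v

theorem DifferentiableAt.hasLineDerivAt_inr {f : A × D → F} {p : A × D}
    (h : DifferentiableAt ℝ (fun t => f (p.1, t)) p.2) (v : D) :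
    HasLineDerivAt ℝ f (fderiv ℝ (fun t => f (p.1, t)) p.2 v) p (0, v) := by
  obtain ⟨a, t⟩ := p
  simpa [HasLineDerivAt] using h.hasFDerivAt.hasLineDerivAt v

variable [FiniteDimensional ℝ A]

/-- A linear map that extends the partial Jacobians of `f` where these exist and, if the
additive directions project onto the second factor, also the line derivatives along them. -/
theorem exists_clm_extending_partial_fderiv [FiniteDimensional ℝ D] (f : A × D → F) (p : A × D) :
    ∃ T : A × D →L[ℝ] F,
      (DifferentiableAt ℝ (fun a => f (a, p.2)) p.1 →
        T.comp (ContinuousLinearMap.inl ℝ A D) = fderiv ℝ (fun a => f (a, p.2)) p.1) ∧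
      (DifferentiableAt ℝ (fun t => f (p.1, t)) p.2 →
        T.comp (ContinuousLinearMap.inr ℝ A D) = fderiv ℝ (fun t => f (p.1, t)) p.2) ∧
      ((∀ v : D, ∃ u : A, (u, v) ∈ additiveDirections f p) →
        ∀ w ∈ additiveDirections f p, HasLineDerivAt ℝ f (T w) p w) := by
  by_cases hM : ∀ v : D, ∃ u : A, (u, v) ∈ additiveDirections f p
  · by_cases h₁ : DifferentiableAt ℝ (fun a => f (a, p.2)) p.1
    · obtain ⟨T, hT⟩ := exists_clm_hasLineDerivAt_sup (f := f) (p := p)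
        (W := LinearMap.range (LinearMap.inl ℝ A D))
        (S := (fderiv ℝ (fun a => f (a, p.2)) p.1).comp (ContinuousLinearMap.fst ℝ A D)) (by
          rintro _ ⟨v, rfl⟩
          exact h₁.hasLineDerivAt_inl v)
      -- The first factor and the additive directions span everything, so `T` gives all line
      -- derivatives and matches the second partial Jacobian automatically.
      have hT' : ∀ w, HasLineDerivAt ℝ f (T w) p w := by
        rintro ⟨a, v⟩
        obtain ⟨u, hu⟩ := hM v
        refine hT _ (Submodule.mem_sup.2 ⟨_, hu, (a - u, 0), ⟨a - u, rfl⟩, by simp⟩)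
      refine ⟨T, fun _ => ?_, fun h₂ => ?_, fun _ w _ => hT' w⟩
      · ext v
        exact (hT' (v, 0)).unique (h₁.hasLineDerivAt_inl v)
      · ext v
        exact (hT' (0, v)).unique (h₂.hasLineDerivAt_inr v)
    · by_cases h₂ : DifferentiableAt ℝ (fun t => f (p.1, t)) p.2
      · obtain ⟨T, hT⟩ := exists_clm_hasLineDerivAt_sup (f := f) (p := p)
          (W := LinearMap.range (LinearMap.inr ℝ A D))
          (S := (fderiv ℝ (fun t => f (p.1, t)) p.2).comp (ContinuousLinearMap.snd ℝ A D)) (by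
            rintro _ ⟨v, rfl⟩
            exact h₂.hasLineDerivAt_inr v)
        refine ⟨T, fun h => absurd h h₁, fun _ => ?_,
          fun _ w hw => hT w (Submodule.mem_sup_left hw)⟩
        ext v
        exact (hT (0, v) (Submodule.mem_sup_right ⟨v, rfl⟩)).unique (h₂.hasLineDerivAt_inr v)
      · obtain ⟨T, hT⟩ := exists_clm_hasLineDerivAt_additiveDirections f p
        exact ⟨T, fun h => absurd h h₁, fun h => absurd h h₂, fun _ => hT⟩
  -- Without the projection property only the partial Jacobians matter, and they can be prescribed
  -- independently.
  · exact ⟨(fderiv ℝ (fun a => f (a, p.2)) p.1).coprod (fderiv ℝ (fun t => f (p.1, t)) p.2),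
      fun _ => by ext v; simp, fun _ => by ext v; simp, fun h => absurd h hM⟩

/-- A linear map that equals the Jacobian of `f` where it exists and extends the line derivatives
of `f` along its additive directions. -/
theorem exists_clm_extending_fderiv (f : A → F) (p : A) :
    ∃ T : A →L[ℝ] F, (DifferentiableAt ℝ f p → T = fderiv ℝ f p) ∧
      ∀ w ∈ additiveDirections f p, HasLineDerivAt ℝ f (T w) p w := by
  by_cases h : DifferentiableAt ℝ f p
  · exact ⟨fderiv ℝ f p, fun _ => rfl, fun w _ => h.hasFDerivAt.hasLineDerivAt w⟩
  · obtain ⟨T, hT⟩ := exists_clm_hasLineDerivAt_additiveDirections f p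
    exact ⟨T, fun h' => absurd h' h, hT⟩

end PartialDerivatives

/-! ### Extension to the whole space and the recursion. -/

theorem LipschitzOnWith.prod_of_separately {A D F : Type*} [PseudoMetricSpace A]
    [PseudoMetricSpace D] [PseudoMetricSpace F] {f : A × D → F} {s : Set D} {K₁ K₂ : NNReal}
    (h₁ : ∀ t ∈ s, LipschitzWith K₁ fun a => f (a, t))
    (h₂ : ∀ a, LipschitzOnWith K₂ (fun t => f (a, t)) s) :
    LipschitzOnWith (K₁ + K₂) f (univ ×ˢ s) := by
  refine LipschitzOnWith.of_dist_le_mul ?_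
  rintro ⟨a, t⟩ ⟨-, ht⟩ ⟨b, r⟩ ⟨-, hr⟩
  calc dist (f (a, t)) (f (b, r)) ≤ dist (f (a, t)) (f (b, t)) + dist (f (b, t)) (f (b, r)) :=
        dist_triangle _ _ _
    _ ≤ K₁ * dist a b + K₂ * dist t r :=
        add_le_add ((h₁ t ht).dist_le_mul a b) ((h₂ b).dist_le_mul t ht r hr)
    _ ≤ K₁ * dist (a, t) (b, r) + K₂ * dist (a, t) (b, r) := by
        gcongr
        · exact le_max_left _ _
        · exact le_max_right _ _
    _ = ↑(K₁ + K₂) * dist (a, t) (b, r) := by push_cast; ring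

theorem mainTheorem7 {m N P d : ℕ}
    (Θ : Set (EuclideanSpace ℝ (Fin d))) (hΘ : IsOpen Θ)
    (γ : EuclideanSpace ℝ (Fin m) → EuclideanSpace ℝ (Fin N))
    (ψ : EuclideanSpace ℝ (Fin m) → EuclideanSpace ℝ (Fin P) → EuclideanSpace ℝ (Fin d) →
      EuclideanSpace ℝ (Fin m))
    (a₀ : EuclideanSpace ℝ (Fin P) → EuclideanSpace ℝ (Fin d) → EuclideanSpace ℝ (Fin m))
    (y : EuclideanSpace ℝ (Fin P)) (K₀ K₁ K₃ : NNReal)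
    (hγ : LipschitzWith 1 γ)
    (hψ₁ : ∀ θ ∈ Θ, LipschitzWith K₁ (fun a => ψ a y θ))
    (hψ₃ : ∀ a, LipschitzOnWith K₃ (fun θ => ψ a y θ) Θ)
    (ha₀ : LipschitzOnWith K₀ (fun θ => a₀ y θ) Θ) :
    -- the iterates are weakly differentiable in `θ`
    (∀ l, WeaklyDifferentiableOn Θ (auxIterate ψ a₀ l y)) ∧
    (∀ l, WeaklyDifferentiableOn Θ (mainIterate γ ψ a₀ l y)) ∧
    -- there are versions `Γ`, `Ψa`, `Ψθ` of the weak Jacobians of `γ`, of `ψ` in its first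
    -- argument and of `ψ` in its third argument, equal to the classical ones where these exist,
    ∃ (Γ : EuclideanSpace ℝ (Fin m) →
          EuclideanSpace ℝ (Fin m) →L[ℝ] EuclideanSpace ℝ (Fin N))
      (Ψa : EuclideanSpace ℝ (Fin m) → EuclideanSpace ℝ (Fin d) →
          EuclideanSpace ℝ (Fin m) →L[ℝ] EuclideanSpace ℝ (Fin m))
      (Ψθ : EuclideanSpace ℝ (Fin m) → EuclideanSpace ℝ (Fin d) →
          EuclideanSpace ℝ (Fin d) →L[ℝ] EuclideanSpace ℝ (Fin m)),
      IsWeakJacobian Set.univ γ Γ ∧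
      (∀ θ ∈ Θ, IsWeakJacobian Set.univ (fun a => ψ a y θ) (fun a => Ψa a θ)) ∧
      (∀ a, IsWeakJacobian Θ (fun θ => ψ a y θ) (fun θ => Ψθ a θ)) ∧
      (∀ a, DifferentiableAt ℝ γ a → Γ a = fderiv ℝ γ a) ∧
      (∀ a, ∀ θ ∈ Θ, DifferentiableAt ℝ (fun b => ψ b y θ) a →
        Ψa a θ = fderiv ℝ (fun b => ψ b y θ) a) ∧
      (∀ a, ∀ θ ∈ Θ, DifferentiableAt ℝ (fun t => ψ a y t) θ →
        Ψθ a θ = fderiv ℝ (fun t => ψ a y t) θ) ∧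
      -- for which the weak Jacobians in `θ` of the iterates obey the recursion, for a.e. `θ`
      ∀ (Ja : ℕ → EuclideanSpace ℝ (Fin d) →
            EuclideanSpace ℝ (Fin d) →L[ℝ] EuclideanSpace ℝ (Fin m))
        (Jx : ℕ → EuclideanSpace ℝ (Fin d) →
            EuclideanSpace ℝ (Fin d) →L[ℝ] EuclideanSpace ℝ (Fin N)),
        (∀ l, IsWeakJacobian Θ (auxIterate ψ a₀ l y) (Ja l)) →
        (∀ l, IsWeakJacobian Θ (mainIterate γ ψ a₀ l y) (Jx l)) →
        ∀ l,
          (∀ᵐ θ ∂(volume.restrict Θ),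
            Jx l θ = (Γ (auxIterate ψ a₀ l y θ)).comp (Ja l θ)) ∧
          (∀ᵐ θ ∂(volume.restrict Θ),
            Ja (l + 1) θ =
              (Ψa (auxIterate ψ a₀ l y θ) θ).comp (Ja l θ) +
                Ψθ (auxIterate ψ a₀ l y θ) θ) := by
  obtain ⟨F, hF, hFψ⟩ := (LipschitzOnWith.prod_of_separately
    (f := fun q : EuclideanSpace ℝ (Fin m) × EuclideanSpace ℝ (Fin d) => ψ q.1 y q.2)
    hψ₁ hψ₃).extend_finite_dimension
  obtain ⟨b₀, hb₀, hb₀a⟩ := ha₀.extend_finite_dimension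
  replace hFψ : ∀ a, ∀ θ ∈ Θ, ψ a y θ = F (a, θ) := fun a θ hθ =>
    hFψ (x := (a, θ)) ⟨mem_univ a, hθ⟩
  -- the iterates of the globally Lipschitz extensions
  let b : ℕ → EuclideanSpace ℝ (Fin d) → EuclideanSpace ℝ (Fin m) :=
    fun l => Nat.rec b₀ (fun _ c θ => F (c θ, θ)) l
  have hb_succ : ∀ l, b (l + 1) = F ∘ fun θ => (b l θ, θ) := fun l => rfl
  have hb : ∀ l, ∃ C, LipschitzWith C (b l) := by
    intro l
    induction l with
    | zero => exact ⟨_, hb₀⟩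
    | succ l ih =>
      obtain ⟨C, hC⟩ := ih
      exact ⟨_, hF.comp (hC.prodMk LipschitzWith.id)⟩
  choose C hC using hb
  have hbeq : ∀ l, EqOn (b l) (auxIterate ψ a₀ l y) Θ := by
    intro l
    induction l with
    | zero => exact fun θ hθ => (hb₀a hθ).symm
    | succ l ih =>
      intro θ hθ
      change F (b l θ, θ) = ψ (auxIterate ψ a₀ l y θ) y θ
      rw [← ih hθ, hFψ _ _ hθ]
  have hxeq : ∀ l, EqOn (γ ∘ b l) (mainIterate γ ψ a₀ l y) Θ := fun l θ hθ =>
    congrArg γ (hbeq l hθ)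
  have hJb : ∀ l, IsWeakJacobian Θ (auxIterate ψ a₀ l y) (fderiv ℝ (b l)) := fun l =>
    (hC l).isWeakJacobian hΘ.measurableSet (hbeq l) fun _ _ _ => rfl
  have hJx : ∀ l, IsWeakJacobian Θ (mainIterate γ ψ a₀ l y) (fderiv ℝ (γ ∘ b l)) := fun l =>
    (hγ.comp (hC l)).isWeakJacobian hΘ.measurableSet (hxeq l) fun _ _ _ => rfl
  have hF₁ : ∀ θ, LipschitzWith _ fun a => F (a, θ) := fun θ =>
    hF.comp (LipschitzWith.prodMk_right θ)
  have hF₂ : ∀ a, LipschitzWith _ fun θ => F (a, θ) := fun a =>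
    hF.comp (LipschitzWith.prodMk_left a)
  have hψ₁eq : ∀ θ ∈ Θ, (fun a => ψ a y θ) = fun a => F (a, θ) := fun θ hθ =>
    funext fun a => hFψ a θ hθ
  have hψ₃eq : ∀ a, ∀ θ ∈ Θ, (fun t => ψ a y t) =ᶠ[𝓝 θ] fun t => F (a, t) := fun a θ hθ => by
    filter_upwards [hΘ.mem_nhds hθ] with t ht using hFψ a t ht
  -- These choices depend only on `γ`, `F` and the point, not on `l`.
  choose Γ hΓ₁ hΓ₂ using exists_clm_extending_fderiv γ
  choose T hT₁ hT₂ hT₃ using exists_clm_extending_partial_fderiv F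
  refine ⟨fun l => (hJb l).weaklyDifferentiableOn, fun l => (hJx l).weaklyDifferentiableOn, Γ,
    fun a θ => (T (a, θ)).comp (ContinuousLinearMap.inl ℝ _ _),
    fun a θ => (T (a, θ)).comp (ContinuousLinearMap.inr ℝ _ _),
    hγ.isWeakJacobian MeasurableSet.univ (fun _ _ => rfl) fun a _ => hΓ₁ a, ?_, ?_, hΓ₁, ?_, ?_, ?_⟩
  · intro θ hθ
    rw [hψ₁eq θ hθ]
    exact (hF₁ θ).isWeakJacobian MeasurableSet.univ (fun _ _ => rfl) fun a _ => hT₁ (a, θ)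
  · exact fun a => (hF₂ a).isWeakJacobian hΘ.measurableSet (fun θ hθ => (hFψ a θ hθ).symm)
      fun θ _ => hT₂ (a, θ)
  · intro a θ hθ h
    rw [hψ₁eq θ hθ] at h ⊢
    exact hT₁ (a, θ) h
  · intro a θ hθ h
    rw [(hψ₃eq a θ hθ).fderiv_eq]
    exact hT₂ (a, θ) ((hψ₃eq a θ hθ).differentiableAt_iff.1 h)
  -- By uniqueness almost everywhere, arbitrary versions may be replaced by the classical
  -- derivatives of the extended iterates.
  · intro Ja Jx hJa' hJx' l
    have ea : ∀ l, Ja l =ᵐ[volume.restrict Θ] fderiv ℝ (b l) := fun l =>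
      (hJa' l).ae_eq (hJb l) hΘ
    have ex := (hJx' l).ae_eq (hJx l) hΘ
    constructor
    · filter_upwards [ea l, ex, ae_restrict_mem hΘ.measurableSet,
        ae_restrict_of_ae (hγ.ae_fderiv_mem_additiveDirections (hC l))] with θ h₁ h₂ hθ h
      rw [h₁, h₂, ← hbeq l hθ]
      ext1 v
      exact (h v).2.unique (hΓ₂ _ _ (h v).1)
    · filter_upwards [ea l, ea (l + 1), ae_restrict_mem hΘ.measurableSet,
        ae_restrict_of_ae (hF.ae_fderiv_mem_additiveDirections ((hC l).prodMk LipschitzWith.id)),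
        ae_restrict_of_ae (hC l).ae_differentiableAt] with θ h₁ h₂ hθ h hd
      have e : fderiv ℝ (fun t => (b l t, id t)) θ =
          (fderiv ℝ (b l) θ).prod (ContinuousLinearMap.id ℝ _) :=
        (hd.hasFDerivAt.prodMk (hasFDerivAt_id θ)).fderiv
      rw [e] at h
      rw [h₁, h₂, ← hbeq l hθ, hb_succ]
      ext1 v
      -- The tangent vectors `(D(b l)(θ)v, v)` are additive directions for all `v`, which is the
      -- projection property.
      have hv := (h v).2.unique (hT₃ _ (fun v => ⟨_, (h v).1⟩) _ (h v).1)
      refine hv.trans ?_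
      simp [← map_add]
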